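/- Let $\mathcal A$ be a point configuration in $\mathbb R^d$, that is, a finite multiset of points of $\mathbb R^d$ (repeated points are distinguished by labels, and subconfigurations are sets of labels), and suppose that $\mathcal A$ affinely spans $\mathbb R^d$. A subconfiguration $F$ of a subconfiguration $B\subseteq\mathcal A$ is a face of $B$ if $F=\{b\in B : b\in G\}$ for some face $G$ of the polytope $\operatorname{conv} B$ (the polytope itself and the empty set count as faces). A subdivision of $\mathcal A$ is a collection $\Sigma$ of subconfigurations (called the faces of $\Sigma$) such that (1) every face of an $F\in\Sigma$ belongs to $\Sigma$; (2) $\operatorname{conv}\mathcal A=\bigcup_{F\in\Sigma}\operatorname{conv}F$; (3) $\operatorname{relint}(\operatorname{conv}F)\cap\operatorname{relint}(\operatorname{conv}F')=\emptyset$ for all distinct $F,F'\in\Sigma$. The trivial subdivision consists of all faces of $\mathcal A$. A subdivision $\Sigma'$ coarsens $\Sigma$ if every $F\in\Sigma$ is contained in some $F'\in\Sigma'$. A subdivision $\Sigma$ is coarsest if it is not trivial and every subdivision that coarsens it equals $\Sigma$ or the trivial subdivision. A face $F\in\Sigma$ is interior if $\operatorname{conv}F$ is not contained in the boundary of $\operatorname{conv}\mathcal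 A$; its codimension is $d-\dim\operatorname{aff}F$. A $k$-split of $\mathcal A$ is a coarsest subdivision with exactly $k$ inclusion-maximal faces that has an interior face of codimension $k-1$. For a weight function $w:\mathcal A\to\mathbb R$ put $$\mathcal L_w(\mathcal A)=\operatorname{conv}\{(w(a),a) : a\in\mathcal A\}+\mathbb R_{\ge 0}\,(1,0,\dots,0)\subset\mathbb R\times\mathbb R^d .$$ The regular subdivision induced by $w$ consists of the sets $\{b\in\mathcal A : (w(b),b)\in G\}$, where $G$ ranges over the bounded faces of $\mathcal L_w(\mathcal A)$. A subdivision is regular if it is induced by some weight function. **Theorem.** For every $k$, every $k$-split of $\mathcal A$ is a regular subdivision. -/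

import Mathlib

namespace PointConfig

/-!
A point configuration in `ℝ^d` (a finite multiset of points) is a family `a : ι → ℝ^d` over a
finite type `ι` of labels, and a subconfiguration is a set of labels.
-/

variable {d : ℕ} {ι : Type*}

/-- The convex hull of the subconfiguration with label set `F`. -/
def conv (a : ι → EuclideanSpace ℝ (Fin d)) (F : Set ι) : Set (EuclideanSpace ℝ (Fin d)) :=
  convexHull ℝ (a '' F)

/-- `F` is a face of the subconfiguration `B`: it consists of all elements of `B` that lie on some
(exposed) face of the polytope `conv B`. As usual, `B` itself and `∅` count as faces. -/
def IsFace (a : ι → EuclideanSpace ℝ (Fin d)) (F B : Set ι) : Prop :=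
  ∃ G, IsExposed ℝ (conv a B) G ∧ F = {i | i ∈ B ∧ a i ∈ G}

/-- A collection `S` of subconfigurations is a subdivision of the configuration `a`. -/
structure IsSubdivision (a : ι → EuclideanSpace ℝ (Fin d)) (S : Set (Set ι)) : Prop where
  face_mem : ∀ B ∈ S, ∀ F, IsFace a F B → F ∈ S
  iUnion_conv : conv a Set.univ = ⋃ F ∈ S, conv a F
  disjoint_relint : ∀ F ∈ S, ∀ F' ∈ S, F ≠ F' →
    Disjoint (intrinsicInterior ℝ (conv a F)) (intrinsicInterior ℝ (conv a F'))

/-- The trivial subdivision: all faces of the configuration, including the whole configuration. -/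
def trivialSubdivision (a : ι → EuclideanSpace ℝ (Fin d)) : Set (Set ι) :=
  {F | IsFace a F Set.univ}

/-- `S` refines `T` (equivalently, `T` coarsens `S`). -/
def Refines (S T : Set (Set ι)) : Prop :=
  ∀ F ∈ S, ∃ G ∈ T, F ⊆ G

/-- A coarsest subdivision: a non-trivial subdivision whose only proper coarsening is the trivial
subdivision. -/
structure IsCoarsest (a : ι → EuclideanSpace ℝ (Fin d)) (S : Set (Set ι)) : Prop where
  isSubdivision : IsSubdivision a S
  ne_trivial : S ≠ trivialSubdivision a
  coarsening : ∀ T, IsSubdivision a T → Refines S T → T = S ∨ T = trivialSubdivision a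

/-- A subconfiguration is interior if its convex hull is not entirely contained in the boundary of
the convex hull of the whole configuration. -/
def IsInterior (a : ι → EuclideanSpace ℝ (Fin d)) (F : Set ι) : Prop :=
  ¬ conv a F ⊆ frontier (conv a Set.univ)

/-- The dimension of (the affine hull of) a subconfiguration. -/
noncomputable def dim (a : ι → EuclideanSpace ℝ (Fin d)) (F : Set ι) : ℕ :=
  Module.finrank ℝ (vectorSpan ℝ (a '' F))

/-- A `k`-split of a `d`-dimensional configuration in `ℝ^d`: a coarsest subdivision with exactly `k`
inclusion-maximal faces that has an interior face of codimension `k - 1`, that is, of dimension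
`d - (k - 1)`. -/
structure IsKSplit (a : ι → EuclideanSpace ℝ (Fin d)) (k : ℕ) (S : Set (Set ι)) : Prop where
  isCoarsest : IsCoarsest a S
  ncard_maximal : {F | Maximal (· ∈ S) F}.ncard = k
  exists_interior : ∃ F ∈ S, IsInterior a F ∧ dim a F + k = d + 1

/-- The lifted polyhedron `conv {(w i, a i)} + ℝ_{≥0} (1, 0)` in `ℝ × ℝ^d`. -/
def lift (a : ι → EuclideanSpace ℝ (Fin d)) (w : ι → ℝ) : Set (ℝ × EuclideanSpace ℝ (Fin d)) :=
  {x | ∃ y ∈ convexHull ℝ (Set.range fun i => (w i, a i)), ∃ t : ℝ, 0 ≤ t ∧ x = y + (t, 0)}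

/-- The regular subdivision induced by `w`: the label sets of the lower (that is, bounded) faces of
the lifted polyhedron. -/
def regularSubdivision (a : ι → EuclideanSpace ℝ (Fin d)) (w : ι → ℝ) : Set (Set ι) :=
  {F | ∃ G, IsExposed ℝ (lift a w) G ∧ Bornology.IsBounded G ∧ F = {i | (w i, a i) ∈ G}}

/-- A collection of subconfigurations is a regular subdivision if some weight function induces it. -/
def IsRegular (a : ι → EuclideanSpace ℝ (Fin d)) (S : Set (Set ι)) : Prop :=
  ∃ w : ι → ℝ, S = regularSubdivision a w

end PointConfig

/-!
Let `F` be an interior face of codimension `k - 1`. An interior face of codimension `m` lies in at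
least `m + 1` maximal faces: otherwise the functionals separating it from the maximal faces around
it are so few that some direction out of it is covered by none of them. Hence `F` lies in all `k`
maximal faces. Fix `x` in the relative interior of `F`, and let `V` be the direction of `F`.

The same count applied to the minimal faces above `F` yields, for each maximal face `C`, a ray at
`x` contained in every maximal face except `C`. So around `x` the maximal faces look like the cones
over the facets of a simplex, modulo `V`: the `k` rays live in the `(k - 1)`-dimensional quotient by
`V` and, after rescaling, their only linear relation is that they sum to zero. A vector lies in the
cone of `C` precisely when the coefficient of the `C`-th ray is minimal among all its coefficients.
The negated coefficients lift to affine functions `g C` on `ℝ^d`, whose pointwise maximum is convex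
and has the maximal faces as its domains of linearity. Lifting each label by this maximum, and the
labels that belong to no face strictly higher, induces the subdivision.
-/

section Convex

open Set Filter Topology

variable {E : Type*} [AddCommGroup E] [Module ℝ E] {s t : Set E} {x y : E}

theorem isExtreme_setOf_eq_zero {f : E →ᵃ[ℝ] ℝ} (hf : ∀ y ∈ s, f y ≤ 0) :
    IsExtreme ℝ s {y | y ∈ s ∧ f y = 0} := by
  refine ⟨fun y hy => hy.1, fun y hy y' hy' z hz hzy => ⟨hy, ?_⟩⟩
  obtain ⟨α, β, hα, hβ, hαβ, rfl⟩ := hzy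
  have hfz : α • f y + β • f y' = 0 := (Convex.combo_affine_apply hαβ).symm.trans hz.2
  simp only [smul_eq_mul] at hfz
  nlinarith [hf y hy, hf y' hy', mul_nonneg hβ.le (neg_nonneg.2 (hf y' hy'))]

theorem isExposed_iff_exists_affineMap {E : Type*} [NormedAddCommGroup E] [NormedSpace ℝ E]
    [FiniteDimensional ℝ E] {A G : Set E} : IsExposed ℝ A G ↔
      ∃ f : E →ᵃ[ℝ] ℝ, (∀ y ∈ A, f y ≤ 0) ∧ G = {y | y ∈ A ∧ f y = 0} := by
  constructor
  · intro hG
    rcases G.eq_empty_or_nonempty with rfl | ⟨z, hz⟩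
    · exact ⟨AffineMap.const ℝ E (-1), by simp, by simp⟩
    obtain ⟨l, rfl⟩ := hG ⟨z, hz⟩
    refine ⟨(l : E →ₗ[ℝ] ℝ).toAffineMap - AffineMap.const ℝ E (l z),
      fun y hy => by simpa using hz.2 y hy, ext fun y => and_congr_right fun hy => ?_⟩
    have hmax : (∀ y' ∈ A, l y' ≤ l y) ↔ l y = l z :=
      ⟨fun h => (hz.2 y hy).antisymm (h z hz.1), fun h => h ▸ hz.2⟩
    simpa [sub_eq_zero] using hmax
  · rintro ⟨f, hf, rfl⟩ ⟨z, hz, hfz⟩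
    refine ⟨f.linear.toContinuousLinearMap, ext fun y => and_congr_right fun hy => ?_⟩
    have hlin : ∀ y y', f.linear y ≤ f.linear y' ↔ f y ≤ f y' := fun y y' => by
      rw [← sub_nonneg, ← map_sub, ← vsub_eq_sub, f.linearMap_vsub, vsub_eq_sub, sub_nonneg]
    simp only [LinearMap.coe_toContinuousLinearMap', hlin]
    exact ⟨fun h y' hy' => h ▸ hf y' hy', fun h => (hf y hy).antisymm (hfz ▸ h z hz)⟩

theorem convexHull_sep_eq_zero {f : E →ᵃ[ℝ] ℝ} (hf : ∀ y ∈ s, f y ≤ 0) :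
    convexHull ℝ {y | y ∈ s ∧ f y = 0} = {y | y ∈ convexHull ℝ s ∧ f y = 0} := by
  refine Subset.antisymm ?_ ?_
  · exact convexHull_min (fun y hy => ⟨subset_convexHull ℝ s hy.1, hy.2⟩)
      ((convex_convexHull ℝ s).inter ((convex_singleton (0 : ℝ)).affine_preimage f))
  · set F : Set E := {y | y ∈ s ∧ f y = 0}
    have hconv : Convex ℝ {y | f y < 0 ∨ (f y = 0 ∧ y ∈ convexHull ℝ F)} := by
      refine convex_iff_forall_pos.2 fun y hy z hz α β hα hβ hαβ => ?_
      rw [mem_ofPred, Convex.combo_affine_apply hαβ, smul_eq_mul, smul_eq_mul]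
      rcases hy with hy | ⟨hy, hyF⟩ <;> rcases hz with hz | ⟨hz, hzF⟩
      · exact .inl (by nlinarith)
      · exact .inl (by nlinarith)
      · exact .inl (by nlinarith)
      · exact .inr ⟨by simp [hy, hz], convex_convexHull ℝ F hyF hzF hα.le hβ.le hαβ⟩
    rintro y ⟨hy, hfy⟩
    have := convexHull_min (fun y hy => ?_) hconv hy
    · exact (this.resolve_left hfy.not_lt).2
    · exact (hf y hy).lt_or_eq.imp_right fun h => ⟨h, subset_convexHull ℝ F ⟨hy, h⟩⟩

/-- The cone of feasible directions of the set `s` at the point `x`. For `x ∈ s` with `s` convex,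
these are the directions in which one can leave `x` and stay in `s` for a while. -/
def dirCone (s : Set E) (x : E) : ConvexCone ℝ E :=
  ConvexCone.hull ℝ ((x + ·) ⁻¹' s)

theorem mem_dirCone (hs : Convex ℝ s) : y ∈ dirCone s x ↔ ∃ ε : ℝ, 0 < ε ∧ x + ε • y ∈ s := by
  rw [dirCone, ConvexCone.mem_hull_of_convex (hs.translate_preimage_right x)]
  constructor
  · rintro ⟨r, hr, z, hz, rfl⟩
    exact ⟨r⁻¹, inv_pos.2 hr, by simpa [smul_smul, hr.ne'] using hz⟩
  · rintro ⟨ε, hε, h⟩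
    exact ⟨ε⁻¹, inv_pos.2 hε, (mem_inv_smul_set_iff₀ hε.ne' _ _).2 h⟩

theorem sub_mem_dirCone (hy : y ∈ s) : y - x ∈ dirCone s x :=
  ConvexCone.subset_hull (by simpa using hy)

theorem dirCone_mono (h : s ⊆ t) : dirCone s x ≤ dirCone t x :=
  ConvexCone.hull_min fun _ hy => ConvexCone.subset_hull (h hy)

theorem eventually_add_smul_mem_of_mem_dirCone (hs : Convex ℝ s) (hx : x ∈ s)
    (hy : y ∈ dirCone s x) : ∀ᶠ ε in 𝓝[>] (0 : ℝ), x + ε • y ∈ s := by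
  obtain ⟨ε, hε, h⟩ := (mem_dirCone hs).1 hy
  filter_upwards [Ioc_mem_nhdsGT hε] with δ hδ
  have hmem := hs.add_smul_mem hx h (t := δ / ε)
    ⟨div_nonneg hδ.1.le hε.le, (div_le_one hε).2 hδ.2⟩
  rwa [smul_smul, div_mul_cancel₀ _ hε.ne'] at hmem

end Convex

section IntrinsicInterior

open Set Filter Topology

variable {E : Type*} [NormedAddCommGroup E] [NormedSpace ℝ E] {s t A : Set E} {x y z v : E}

theorem exists_add_smul_mem_of_mem_intrinsicInterior (hz : z ∈ intrinsicInterior ℝ s)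
    (hv : v ∈ vectorSpan ℝ s) : ∃ ε : ℝ, 0 < ε ∧ z + ε • v ∈ s := by
  obtain ⟨p, hp, rfl⟩ := mem_intrinsicInterior.1 hz
  have hmem : ∀ ε : ℝ, (p : E) + ε • v ∈ affineSpan ℝ s := fun ε => by
    rw [add_comm]
    refine AffineSubspace.vadd_mem_of_mem_direction ?_ p.2
    rw [direction_affineSpan]
    exact Submodule.smul_mem _ ε hv
  let γ : ℝ → affineSpan ℝ s := fun ε => ⟨p + ε • v, hmem ε⟩
  have hγ : Continuous γ := by fun_prop
  have hγ0 : γ 0 = p := Subtype.ext (by simp [γ])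
  have hnhds : γ ⁻¹' interior (Subtype.val ⁻¹' s) ∈ 𝓝 0 :=
    hγ.continuousAt.preimage_mem_nhds (hγ0.symm ▸ isOpen_interior.mem_nhds hp)
  obtain ⟨ε, hε, hmem⟩ := ((eventually_mem_nhdsWithin (s := Ioi 0)).and
    (mem_nhdsWithin_of_mem_nhds hnhds)).exists
  exact ⟨ε, hε, (interior_subset hmem : γ ε ∈ Subtype.val ⁻¹' s)⟩

theorem exists_mem_openSegment_of_mem_intrinsicInterior (hz : z ∈ intrinsicInterior ℝ s)
    (hy : y ∈ s) : ∃ y' ∈ s, z ∈ openSegment ℝ y y' := by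
  have hv : z - y ∈ vectorSpan ℝ s := vsub_mem_vectorSpan ℝ (intrinsicInterior_subset hz) hy
  obtain ⟨ε, hε, hmem⟩ := exists_add_smul_mem_of_mem_intrinsicInterior hz hv
  refine ⟨_, hmem, ε / (1 + ε), 1 / (1 + ε), by positivity, by positivity, by field_simp; ring, ?_⟩
  match_scalars <;> field_simp
  ring

theorem subset_of_isExtreme_of_mem_intrinsicInterior (hA : IsExtreme ℝ t A) (hst : s ⊆ t)
    (hz : z ∈ intrinsicInterior ℝ s) (hzA : z ∈ A) : s ⊆ A := fun y hy => by
  obtain ⟨y', hy', hzy⟩ := exists_mem_openSegment_of_mem_intrinsicInterior hz hy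
  exact hA.left_mem_of_mem_openSegment (hst hy) (hst hy') hzA hzy

theorem exists_affineMap_of_notMem_intrinsicInterior [FiniteDimensional ℝ E] (hs : Convex ℝ s)
    (hz : z ∈ s) (hz' : z ∉ intrinsicInterior ℝ s) :
    ∃ f : E →ᵃ[ℝ] ℝ, (∀ y ∈ s, f y ≤ 0) ∧ f z = 0 ∧ ∃ y ∈ s, f y ≠ 0 := by
  let W := vectorSpan ℝ s
  let φ : W →ᵃⁱ[ℝ] E :=
    (AffineIsometryEquiv.vaddConst ℝ z).toAffineIsometry.comp W.subtypeₗᵢ.toAffineIsometry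
  let T : Set W := φ ⁻¹' s
  have hTs : φ '' T = s := image_preimage_eq_of_subset fun y hy =>
    ⟨⟨y - z, vsub_mem_vectorSpan ℝ hy hz⟩, by simp [φ]⟩
  have h0 : (0 : W) ∈ T := by simpa [T, φ] using hz
  have hTspan : affineSpan ℝ T = ⊤ := by
    rw [AffineSubspace.affineSpan_eq_top_iff_vectorSpan_eq_top_of_nonempty _ _ _ ⟨0, h0⟩]
    refine Submodule.map_injective_of_injective W.subtype_injective ?_
    rw [Submodule.map_subtype_top]
    conv_rhs => rw [show W = vectorSpan ℝ s from rfl, ← hTs]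
    exact AffineMap.map_vectorSpan φ.toAffineMap
  have hTconv : Convex ℝ T := hs.affine_preimage φ.toAffineMap
  have h0int : (0 : W) ∉ interior T := fun h => hz' <| by
    rw [← hTs, φ.intrinsicInterior_image]
    exact ⟨0, interior_subset_intrinsicInterior h, by simp [φ]⟩
  obtain ⟨f, hf, hfT⟩ := geometric_hahn_banach_of_nonempty_interior_point hTconv h0int
    (hTconv.interior_nonempty_iff_affineSpan_eq_top.2 hTspan)
  obtain ⟨g, hg⟩ := LinearMap.exists_extend (f : W →ₗ[ℝ] ℝ)
  let F : E →ᵃ[ℝ] ℝ := g.toAffineMap - AffineMap.const ℝ E (g z)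
  have hF : ∀ v : W, F (φ v) = f v := fun v => by
    simpa [F, φ] using LinearMap.congr_fun hg v
  refine ⟨F, fun y hy => ?_, by simp [F], ?_⟩
  · obtain ⟨v, hv, rfl⟩ := hTs.symm ▸ hy
    simpa [hF] using hfT v hv
  · by_contra! hzero
    have hfzero : (f : W →ₗ[ℝ] ℝ).toAffineMap = 0 :=
      AffineMap.ext_on hTspan fun v hv => by simpa [hF] using hzero (φ v) hv
    exact hf (ContinuousLinearMap.ext fun v => DFunLike.congr_fun hfzero v)

theorem mem_intrinsicInterior_of_mem_openSegment [FiniteDimensional ℝ E] (hs : Convex ℝ s)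
    (hx : x ∈ s) (hy : y ∈ intrinsicInterior ℝ s) (hz : z ∈ openSegment ℝ x y) :
    z ∈ intrinsicInterior ℝ s := by
  have hys : y ∈ s := intrinsicInterior_subset hy
  by_contra hz'
  obtain ⟨f, hf, hfz, w, hw, hfw⟩ :=
    exists_affineMap_of_notMem_intrinsicInterior hs (hs.openSegment_subset hx hys hz) hz'
  have hface := isExtreme_setOf_eq_zero hf
  have hfy := hface.right_mem_of_mem_openSegment hx hys
    ⟨hs.openSegment_subset hx hys hz, hfz⟩ hz
  exact hfw (subset_of_isExtreme_of_mem_intrinsicInterior hface Subset.rfl hy hfy hw).2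

theorem vectorSpan_subset_dirCone (hs : Convex ℝ s) (hz : z ∈ intrinsicInterior ℝ s) :
    (vectorSpan ℝ s : Set E) ⊆ dirCone s z := fun _ hv =>
  (mem_dirCone hs).2 (exists_add_smul_mem_of_mem_intrinsicInterior hz hv)

end IntrinsicInterior

section Fan

open Finset Module

variable {𝕜 E J : Type*} [Field 𝕜] [LinearOrder 𝕜] [AddCommGroup E] [Module 𝕜 E]

theorem exists_notMem_forall_nonneg [IsStrictOrderedRing 𝕜] [FiniteDimensional 𝕜 E] [Fintype J]
    [Nonempty J] {V : Submodule 𝕜 E} {f : J → Dual 𝕜 E} (hf : ∀ j, V ≤ LinearMap.ker (f j))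
    (hcard : finrank 𝕜 V + Fintype.card J ≤ finrank 𝕜 E) : ∃ y ∉ V, ∀ j, 0 ≤ f j y := by
  by_cases hker : LinearMap.ker (LinearMap.pi f) ≤ V
  · have hsurj : LinearMap.range (LinearMap.pi f) = ⊤ := by
      apply Submodule.eq_top_of_finrank_eq
      have hrank := (LinearMap.pi f).finrank_range_add_finrank_ker
      have hle := (LinearMap.range (LinearMap.pi f)).finrank_le
      have hmono := Submodule.finrank_mono hker
      rw [finrank_fintype_fun_eq_card] at hle ⊢
      lia
    obtain ⟨y, hy⟩ := LinearMap.range_eq_top.1 hsurj 1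
    have hy : ∀ j, f j y = 1 := fun j => congrFun hy j
    refine ⟨y, fun hyV => ?_, fun j => by simp [hy j]⟩
    obtain ⟨j⟩ := ‹Nonempty J›
    exact one_ne_zero ((hy j).symm.trans (hf j hyV))
  · obtain ⟨y, hy, hyV⟩ := SetLike.not_le_iff_exists.1 hker
    exact ⟨y, hyV, fun j => (congrFun hy j).ge⟩

/-- The cones `K j`, which contain the linear space `V` and meet in common faces, look like the
cones over the facets of a simplex: each has a vector `r i` on every ray but one, and `r i` is
missing only from `K i`. -/
structure IsSimplexFan (V : Submodule 𝕜 E) (K : J → ConvexCone 𝕜 E) (r : J → E) : Prop where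
  submodule_subset : ∀ j, (V : Set E) ⊆ K j
  mem_of_add_mem : ∀ {i j x y}, x ∈ K i → y ∈ K i → x + y ∈ K j → x ∈ K j
  ray_mem_iff : ∀ {i j}, r i ∈ K j ↔ i ≠ j

namespace IsSimplexFan

variable {V : Submodule 𝕜 E} {K : J → ConvexCone 𝕜 E} {r : J → E} {c : J → 𝕜} {j l : J} {y : E}

theorem pos_smul [IsStrictOrderedRing 𝕜] (h : IsSimplexFan V K r) (hc : ∀ i, 0 < c i) :
    IsSimplexFan V K fun i => c i • r i where
  submodule_subset := h.submodule_subset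
  mem_of_add_mem := h.mem_of_add_mem
  ray_mem_iff {i j} := ((K j).smul_mem_iff (hc i)).trans h.ray_mem_iff

variable [Fintype J]

theorem sum_smul_mem (h : IsSimplexFan V K r) (hc : 0 ≤ c) (hj : c j = 0) :
    ∑ i, c i • r i ∈ K j := by
  have hzero : (0 : E) ∈ K j := h.submodule_subset j V.zero_mem
  refine sum_induction _ (· ∈ K j) (fun x y hx hy => (K j).add_mem hx hy) hzero fun i _ => ?_
  rcases (hc i).eq_or_lt with hi | hi
  · simpa [← hi] using hzero
  · exact (K j).smul_mem hi (h.ray_mem_iff.2 fun hij => hi.ne' (hij ▸ hj))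

variable [IsStrictOrderedRing 𝕜]

theorem mem_iff_coeff_eq_zero (h : IsSimplexFan V K r) (hc : 0 ≤ c) (hj : c j = 0)
    (hy : y - ∑ i, c i • r i ∈ V) : y ∈ K l ↔ c l = 0 := by
  classical
  refine ⟨fun hyl => ?_, fun hl => ?_⟩
  · by_contra hne
    have hpos : 0 < c l := (hc l).lt_of_ne' hne
    have hlj : l ≠ j := fun hlj => hne (hlj ▸ hj)
    have hrest : ∑ i, Function.update c l 0 i • r i ∈ K j := by
      refine h.sum_smul_mem (fun i => ?_) (by rwa [Function.update_of_ne hlj.symm])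
      rcases eq_or_ne i l with rfl | hi
      · simp
      · simpa [hi] using hc i
    have hsplit : c l • r l + (∑ i, Function.update c l 0 i • r i + (y - ∑ i, c i • r i)) = y := by
      simp only [← add_sum_erase _ _ (mem_univ l), Function.update_self, zero_smul, zero_add]
      rw [sum_congr rfl fun i hi => by rw [Function.update_of_ne (ne_of_mem_erase hi)]]
      abel
    have hmem : c l • r l ∈ K l :=
      h.mem_of_add_mem ((K j).smul_mem hpos (h.ray_mem_iff.2 hlj))
        ((K j).add_mem hrest (h.submodule_subset j hy)) (by rwa [hsplit])
    exact h.ray_mem_iff.1 (((K l).smul_mem_iff hpos).1 hmem) rfl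
  · simpa using (K l).add_mem (h.sum_smul_mem hc hl) (h.submodule_subset l hy)

theorem coeff_nonpos (h : IsSimplexFan V K r) (hV : ∑ i, c i • r i ∈ V) (hj : c j ≤ 0) (l : J) :
    c l ≤ 0 := by
  by_contra! hl
  have hmem : ∑ i, c⁺ i • r i ∈ K l := by
    refine (h.mem_iff_coeff_eq_zero (negPart_nonneg c) (j := l) ?_ ?_).2 ?_
    · simpa using hl.le
    · rw [← sum_sub_distrib]
      convert hV using 2
      rw [← sub_smul, ← Pi.sub_apply, posPart_sub_negPart]
    · simpa using hl.le
  have := (h.mem_iff_coeff_eq_zero (posPart_nonneg c) (j := j) (by simpa using hj)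
    (by simp)).1 hmem
  exact hl.not_ge (by simpa using this)

theorem eq_zero_of_coeff_eq_zero (h : IsSimplexFan V K r) (hV : ∑ i, c i • r i ∈ V)
    (hj : c j = 0) : c = 0 := by
  have hneg : ∑ i, (-c) i • r i ∈ V := by simpa using hV
  funext l
  exact (h.coeff_nonpos hV hj.le l).antisymm <| by
    simpa using h.coeff_nonpos hneg (j := j) (by simp [hj]) l

theorem mem_iff_coeff_le (h : IsSimplexFan V K r) (hr : ∑ i, r i ∈ V)
    (hy : y - ∑ i, c i • r i ∈ V) : y ∈ K j ↔ ∀ i, c j ≤ c i := by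
  have : Nonempty J := ⟨j⟩
  obtain ⟨m, hm⟩ := Finite.exists_min c
  have hshift : y - ∑ i, (c i - c m) • r i ∈ V := by
    convert V.add_mem hy (V.smul_mem (c m) hr) using 1
    simp only [sub_smul, sum_sub_distrib, smul_sum]
    abel
  rw [h.mem_iff_coeff_eq_zero (c := fun i => c i - c m) (j := m) (fun i => sub_nonneg.2 (hm i))
    (sub_self _) hshift, sub_eq_zero]
  exact ⟨fun hj i => hj ▸ hm i, fun hj => (hj m).antisymm (hm j)⟩

variable [FiniteDimensional 𝕜 E]

theorem exists_pos_sum_smul_mem (h : IsSimplexFan V K r)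
    (hcard : finrank 𝕜 E < finrank 𝕜 V + Fintype.card J) :
    ∃ c : J → 𝕜, (∀ i, 0 < c i) ∧ ∑ i, c i • r i ∈ V := by
  let Ψ : (J → 𝕜) →ₗ[𝕜] E ⧸ V := V.mkQ ∘ₗ Fintype.linearCombination 𝕜 r
  have hker : ∀ {c}, c ∈ LinearMap.ker Ψ ↔ ∑ i, c i • r i ∈ V :=
    LinearMap.mem_ker.trans (Submodule.Quotient.mk_eq_zero V)
  have hlt : finrank 𝕜 (E ⧸ V) < finrank 𝕜 (J → 𝕜) := by
    rw [finrank_fintype_fun_eq_card]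
    have := V.finrank_quotient_add_finrank
    lia
  obtain ⟨e, he, hne⟩ := (Submodule.ne_bot_iff _).1 (LinearMap.ker_ne_bot_of_finrank_lt hlt)
  by_cases hpos : ∀ i, 0 < e i
  · exact ⟨e, hpos, hker.1 he⟩
  · obtain ⟨j, hj⟩ := not_forall.1 hpos
    refine ⟨-e, fun i => ?_, hker.1 (neg_mem he)⟩
    have hi : e i ≠ 0 := fun hi => hne (h.eq_zero_of_coeff_eq_zero (hker.1 he) hi)
    simpa using (h.coeff_nonpos (hker.1 he) (not_lt.1 hj) i).lt_of_ne hi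

theorem exists_coordinates (h : IsSimplexFan V K r) (hr : ∑ i, r i ∈ V)
    (hcard : finrank 𝕜 E < finrank 𝕜 V + Fintype.card J) :
    ∃ σ : E →ₗ[𝕜] J → 𝕜, ∀ y, y - ∑ i, σ y i • r i ∈ V := by
  let Ψ : (J → 𝕜) →ₗ[𝕜] E ⧸ V := V.mkQ ∘ₗ Fintype.linearCombination 𝕜 r
  have hker_iff : ∀ {c}, c ∈ LinearMap.ker Ψ ↔ ∑ i, c i • r i ∈ V :=
    LinearMap.mem_ker.trans (Submodule.Quotient.mk_eq_zero V)
  have hker : finrank 𝕜 (LinearMap.ker Ψ) ≤ 1 := by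
    have hone : (1 : J → 𝕜) ∈ LinearMap.ker Ψ := hker_iff.2 (by simpa using hr)
    refine finrank_le_one (⟨1, hone⟩ : LinearMap.ker Ψ) fun ⟨c, hc⟩ => ?_
    rcases isEmpty_or_nonempty J with hJ | ⟨⟨j⟩⟩
    · exact ⟨0, Subsingleton.elim _ _⟩
    · have hdiff : c - c j • 1 ∈ LinearMap.ker Ψ := sub_mem hc (Submodule.smul_mem _ _ hone)
      refine ⟨c j, Subtype.ext (sub_eq_zero.1 ?_).symm⟩
      exact h.eq_zero_of_coeff_eq_zero (hker_iff.1 hdiff) (j := j) (by simp)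
  have hsurj : LinearMap.range Ψ = ⊤ := by
    apply Submodule.eq_top_of_finrank_eq
    have hrank := Ψ.finrank_range_add_finrank_ker
    have hle := (LinearMap.range Ψ).finrank_le
    have hquot := V.finrank_quotient_add_finrank
    rw [finrank_fintype_fun_eq_card] at hrank
    lia
  obtain ⟨σ, hσ⟩ := Ψ.exists_rightInverse_of_surjective hsurj
  refine ⟨σ ∘ₗ V.mkQ, fun y => (Submodule.Quotient.eq V).1 ?_⟩
  exact (LinearMap.congr_fun hσ (V.mkQ y)).symm

theorem exists_dual (h : IsSimplexFan V K r)
    (hcard : finrank 𝕜 E < finrank 𝕜 V + Fintype.card J) :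
    ∃ g : J → Dual 𝕜 E, ∀ j y, y ∈ K j ↔ ∀ i, g i y ≤ g j y := by
  obtain ⟨c, hc, hV⟩ := h.exists_pos_sum_smul_mem hcard
  obtain ⟨σ, hσ⟩ := (h.pos_smul hc).exists_coordinates hV hcard
  refine ⟨fun j => -(LinearMap.proj j ∘ₗ σ), fun j y => ?_⟩
  simpa using (h.pos_smul hc).mem_iff_coeff_le hV (hσ y)

end IsSimplexFan

end Fan

namespace PointConfig

section Faces

open Set Filter

variable {d : ℕ} {ι : Type*} {a : ι → EuclideanSpace ℝ (Fin d)} {B C F G H : Set ι}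
  {z : EuclideanSpace ℝ (Fin d)} {f g : EuclideanSpace ℝ (Fin d) →ᵃ[ℝ] ℝ} {i : ι}

theorem convex_conv : Convex ℝ (conv a B) :=
  convex_convexHull ℝ _

theorem mem_conv_of_mem (hi : i ∈ B) : a i ∈ conv a B :=
  subset_convexHull ℝ _ (mem_image_of_mem a hi)

theorem conv_mono (h : F ⊆ B) : conv a F ⊆ conv a B :=
  convexHull_mono (image_mono h)

theorem isClosed_conv [Finite ι] : IsClosed (conv a B) :=
  (toFinite (a '' B)).isClosed_convexHull ℝ

theorem vectorSpan_conv : vectorSpan ℝ (conv a B) = vectorSpan ℝ (a '' B) := by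
  rw [conv, ← direction_affineSpan, affineSpan_convexHull, direction_affineSpan]

theorem conv_nonempty : (conv a B).Nonempty ↔ B.Nonempty := by
  rw [conv, convexHull_nonempty_iff, image_nonempty]

theorem nonpos_of_mem_conv (hf : ∀ i ∈ B, f (a i) ≤ 0) (hz : z ∈ conv a B) : f z ≤ 0 :=
  convexHull_min (s := a '' B) (forall_mem_image.2 hf) ((convex_Iic 0).affine_preimage f) hz

theorem conv_sep_eq_zero (hf : ∀ i ∈ B, f (a i) ≤ 0) :
    conv a {i | i ∈ B ∧ f (a i) = 0} = {y | y ∈ conv a B ∧ f y = 0} := by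
  have himage : a '' {i | i ∈ B ∧ f (a i) = 0} = {y | y ∈ a '' B ∧ f y = 0} := by
    ext y
    constructor
    · rintro ⟨i, ⟨hi, hfi⟩, rfl⟩
      exact ⟨mem_image_of_mem a hi, hfi⟩
    · rintro ⟨⟨i, hi, rfl⟩, hfi⟩
      exact ⟨i, ⟨hi, hfi⟩, rfl⟩
  rw [conv, himage, convexHull_sep_eq_zero (forall_mem_image.2 hf), conv]

theorem isFace_iff : IsFace a F B ↔ ∃ f : EuclideanSpace ℝ (Fin d) →ᵃ[ℝ] ℝ,
    (∀ i ∈ B, f (a i) ≤ 0) ∧ F = {i | i ∈ B ∧ f (a i) = 0} := by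
  have hsep : ∀ f : EuclideanSpace ℝ (Fin d) →ᵃ[ℝ] ℝ,
      {i | i ∈ B ∧ a i ∈ {y | y ∈ conv a B ∧ f y = 0}} = {i | i ∈ B ∧ f (a i) = 0} := fun f =>
    ext fun i => and_congr_right fun hi => and_iff_right (mem_conv_of_mem hi)
  constructor
  · rintro ⟨G, hG, rfl⟩
    obtain ⟨f, hf, rfl⟩ := isExposed_iff_exists_affineMap.1 hG
    exact ⟨f, fun i hi => hf _ (mem_conv_of_mem hi), hsep f⟩
  · rintro ⟨f, hf, rfl⟩
    exact ⟨_, isExposed_iff_exists_affineMap.2 ⟨f, fun y => nonpos_of_mem_conv hf, rfl⟩,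
      (hsep f).symm⟩

theorem IsFace.refl : IsFace a B B :=
  isFace_iff.2 ⟨0, by simp, by simp⟩

theorem isFace_empty : IsFace a ∅ B :=
  isFace_iff.2 ⟨AffineMap.const ℝ _ (-1), by simp, by simp⟩

theorem IsFace.subset (h : IsFace a F B) : F ⊆ B := by
  obtain ⟨G, -, rfl⟩ := h
  exact fun i hi => hi.1

theorem IsFace.isExtreme (h : IsFace a F B) : IsExtreme ℝ (conv a B) (conv a F) := by
  obtain ⟨f, hf, rfl⟩ := isFace_iff.1 h
  rw [conv_sep_eq_zero hf]
  exact isExtreme_setOf_eq_zero fun y hy => nonpos_of_mem_conv hf hy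

theorem IsFace.mem_of_mem_conv (h : IsFace a F B) (hi : i ∈ B) (hmem : a i ∈ conv a F) :
    i ∈ F := by
  obtain ⟨f, hf, rfl⟩ := isFace_iff.1 h
  rw [conv_sep_eq_zero hf] at hmem
  exact ⟨hi, hmem.2⟩

theorem IsFace.subset_of_mem_intrinsicInterior (h : IsFace a F B) (hG : G ⊆ B)
    (hz : z ∈ intrinsicInterior ℝ (conv a G)) (hzF : z ∈ conv a F) : G ⊆ F := fun _ hi =>
  h.mem_of_mem_conv (hG hi) <|
    subset_of_isExtreme_of_mem_intrinsicInterior h.isExtreme (conv_mono hG) hz hzF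
      (mem_conv_of_mem hi)

theorem IsFace.trans [Finite ι] (hFG : IsFace a F G) (hGB : IsFace a G B) : IsFace a F B := by
  obtain ⟨f, hf, rfl⟩ := isFace_iff.1 hFG
  obtain ⟨g, hg, rfl⟩ := isFace_iff.1 hGB
  have hlarge : ∀ᶠ t : ℝ in atTop, ∀ i ∈ {i | i ∈ B ∧ g (a i) < 0}, f (a i) + t * g (a i) < 0 :=
    (toFinite _).eventually_all.2 fun i hi => Tendsto.eventually_lt_atBot
      (tendsto_atBot_add_const_left _ _ (tendsto_id.atTop_mul_const_of_neg hi.2)) 0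
  obtain ⟨t, ht⟩ := hlarge.exists
  refine isFace_iff.2 ⟨f + t • g, fun i hi => ?_, ext fun i => ?_⟩
  · rcases (hg i hi).lt_or_eq with hgi | hgi
    · exact (ht i ⟨hi, hgi⟩).le
    · simpa [hgi] using hf i ⟨hi, hgi⟩
  · constructor
    · rintro ⟨⟨hi, hgi⟩, hfi⟩
      exact ⟨hi, by simp [hgi, hfi]⟩
    · rintro ⟨hi, hfi⟩
      have hgi : g (a i) = 0 := by
        by_contra hne
        exact (ht i ⟨hi, (hg i hi).lt_of_ne hne⟩).ne hfi
      exact ⟨⟨hi, hgi⟩, by simpa [hgi] using hfi⟩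

theorem exists_isFace_mem_intrinsicInterior [Finite ι] (hz : z ∈ conv a B) :
    ∃ G, IsFace a G B ∧ z ∈ intrinsicInterior ℝ (conv a G) := by
  obtain ⟨G, -, hG⟩ := (toFinite {G | IsFace a G B ∧ z ∈ conv a G}).exists_le_minimal
    ⟨IsFace.refl, hz⟩
  refine ⟨G, hG.prop.1, ?_⟩
  by_contra hrel
  obtain ⟨f, hf, hfz, y, hy, hfy⟩ :=
    exists_affineMap_of_notMem_intrinsicInterior convex_conv hG.prop.2 hrel
  have hfG : ∀ i ∈ G, f (a i) ≤ 0 := fun i hi => hf _ (mem_conv_of_mem hi)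
  have hconv := conv_sep_eq_zero hfG
  have heq : {i | i ∈ G ∧ f (a i) = 0} = G :=
    hG.eq_of_subset ⟨(isFace_iff.2 ⟨f, hfG, rfl⟩).trans hG.prop.1, hconv ▸ ⟨hG.prop.2, hfz⟩⟩
      fun i hi => hi.1
  rw [heq] at hconv
  exact hfy (hconv.subset hy).2

theorem exists_add_smul_nonpos_eq_zero [Finite ι] (hf : ∀ i ∈ B, f (a i) ≤ 0)
    (hg : ∀ i ∈ B, f (a i) = 0 → g (a i) = 0) (hne : ∃ i ∈ B, f (a i) ≠ 0) :
    ∃ t : ℝ, (∀ i ∈ B, (g + t • f) (a i) ≤ 0) ∧ ∃ i ∈ B, f (a i) ≠ 0 ∧ (g + t • f) (a i) = 0 := by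
  obtain ⟨p, ⟨hpB, hpf⟩, hp⟩ := exists_max_image {i | i ∈ B ∧ f (a i) ≠ 0}
    (fun i => g (a i) / -f (a i)) (toFinite _) hne
  refine ⟨g (a p) / -f (a p), fun i hi => ?_, p, hpB, hpf, ?_⟩
  · by_cases hfi : f (a i) = 0
    · simp [hfi, hg i hi hfi]
    · have hle := hp i ⟨hi, hfi⟩
      rw [div_le_iff₀ (neg_pos.2 ((hf i hi).lt_of_ne hfi))] at hle
      simp only [AffineMap.coe_add, AffineMap.coe_smul, Pi.add_apply, Pi.smul_apply, smul_eq_mul]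
      linarith
  · simp only [AffineMap.coe_add, AffineMap.coe_smul, Pi.add_apply, Pi.smul_apply, smul_eq_mul]
    field_simp
    ring

theorem IsFace.exists_ssuperset_inter_eq [Finite ι] (hF : IsFace a F B) (hG : IsFace a G B)
    (hFG : F ⊆ G) (hGB : G ≠ B) : ∃ H, IsFace a H B ∧ F ⊂ H ∧ H ∩ G = F := by
  obtain ⟨f, hf, rfl⟩ := isFace_iff.1 hF
  obtain ⟨g, hg, rfl⟩ := isFace_iff.1 hG
  obtain ⟨q, hqB, hq⟩ : ∃ q ∈ B, g (a q) ≠ 0 := by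
    by_contra! hzero
    exact hGB (Subset.antisymm (fun i hi => hi.1) fun i hi => ⟨hi, hzero i hi⟩)
  obtain ⟨t, ht, p, hpB, hpf, hp⟩ := exists_add_smul_nonpos_eq_zero (g := -g) hf
    (fun i hi hfi => by simp [(hFG ⟨hi, hfi⟩).2]) ⟨q, hqB, fun hfq => hq (hFG ⟨hqB, hfq⟩).2⟩
  have ht0 : t ≠ 0 := by
    rintro rfl
    exact hq ((hg q hqB).antisymm (by simpa using ht q hqB))
  refine ⟨_, isFace_iff.2 ⟨_, ht, rfl⟩, ⟨fun i hi => ⟨hi.1, ?_⟩, fun h => ?_⟩, ?_⟩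
  · simp [hi.2, (hFG hi).2]
  · exact hpf (h ⟨hpB, hp⟩).2
  · refine Subset.antisymm (fun i ⟨hi, hiG⟩ => ⟨hi.1, ?_⟩) fun i hi => ⟨⟨hi.1, ?_⟩, hFG hi⟩
    · simpa [hiG.2, ht0] using hi.2
    · simp [hi.2, (hFG hi).2]

theorem IsFace.vectorSpan_le_of_covBy [Finite ι] (hF : IsFace a F G)
    (hmin : ∀ H, IsFace a H G → F ⊂ H → H = G) {p q : ι} (hq : q ∈ F) (hp : p ∈ G) (hpF : p ∉ F) :
    vectorSpan ℝ (a '' G) ≤ vectorSpan ℝ (a '' F) ⊔ Submodule.span ℝ {a p - a q} := by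
  obtain ⟨f, hf, rfl⟩ := isFace_iff.1 hF
  have hne : ∃ i ∈ G, f (a i) ≠ 0 := ⟨p, hp, fun h => hpF ⟨hp, h⟩⟩
  rw [vectorSpan_eq_span_vsub_set_right ℝ (mem_image_of_mem a hq.1), Submodule.span_le]
  rintro _ ⟨_, ⟨i, hi, rfl⟩, rfl⟩
  by_contra hn
  obtain ⟨l, hli, hl⟩ := Submodule.exists_le_ker_of_notMem hn
  let g : EuclideanSpace ℝ (Fin d) →ᵃ[ℝ] ℝ := l.toAffineMap - AffineMap.const ℝ _ (l (a q))
  have hgapp : ∀ j, g (a j) = l (a j - a q) := by simp [g]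
  have hgF : ∀ j ∈ G, f (a j) = 0 → g (a j) = 0 := fun j hj hfj =>
    (hgapp j).trans <| hl <| Submodule.mem_sup_left <|
      vsub_mem_vectorSpan ℝ (mem_image_of_mem a ⟨hj, hfj⟩) (mem_image_of_mem a hq)
  have hgp : g (a p) = 0 :=
    (hgapp p).trans <| hl <| Submodule.mem_sup_right <| Submodule.mem_span_singleton_self _
  obtain ⟨t, ht, r, hr, hrf, hr0⟩ := exists_add_smul_nonpos_eq_zero hf hgF hne
  have htop : {i | i ∈ G ∧ (g + t • f) (a i) = 0} = G := by
    refine hmin _ (isFace_iff.2 ⟨_, ht, rfl⟩) ⟨fun j hj => ⟨hj.1, ?_⟩, fun h => hrf (h ⟨hr, hr0⟩).2⟩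
    simp [hgF j hj.1 hj.2, hj.2]
  have hzero : ∀ j ∈ G, g (a j) + t * f (a j) = 0 := fun j hj => (htop.symm.subset hj).2
  have ht0 : t = 0 :=
    (mul_eq_zero.1 (by simpa only [hgp, zero_add] using hzero p hp)).resolve_right
      fun h => hpF ⟨hp, h⟩
  exact hli (by simpa [ht0, hgapp] using hzero i hi)

theorem IsFace.dim_le_add_one_of_covBy [Finite ι] (hF : IsFace a F G) (hne : F.Nonempty)
    (hFG : F ⊂ G) (hmin : ∀ H, IsFace a H G → F ⊂ H → H = G) : dim a G ≤ dim a F + 1 := by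
  obtain ⟨q, hq⟩ := hne
  obtain ⟨p, hp, hpF⟩ := exists_of_ssubset hFG
  calc dim a G ≤ _ := Submodule.finrank_mono (hF.vectorSpan_le_of_covBy hmin hq hp hpF)
    _ ≤ _ := Submodule.finrank_add_le_finrank_add_finrank _ _
    _ ≤ dim a F + 1 := Nat.add_le_add_left ((finrank_span_le_card _).trans (by simp)) _

end Faces

section Subdivisions

open Set Filter Topology

variable {d : ℕ} {ι : Type*} {a : ι → EuclideanSpace ℝ (Fin d)} {S : Set (Set ι)}
  {B C D F G : Set ι} {x y z : EuclideanSpace ℝ (Fin d)} {i : ι}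

theorem IsInterior.mono (hF : IsInterior a F) (h : F ⊆ G) : IsInterior a G :=
  fun hG => hF ((conv_mono h).trans hG)

theorem IsInterior.nonempty (hF : IsInterior a F) : F.Nonempty := by
  obtain ⟨z, hz, -⟩ := not_subset.1 hF
  exact conv_nonempty.1 ⟨z, hz⟩

theorem IsInterior.exists_mem_intrinsicInterior (hF : IsInterior a F) :
    ∃ x ∈ intrinsicInterior ℝ (conv a F), x ∈ interior (conv a univ) := by
  obtain ⟨z, hz, hz'⟩ := not_subset.1 hF
  have hzint : z ∈ interior (conv a univ) :=
    not_not.1 fun h => hz' ⟨subset_closure (conv_mono (subset_univ F) hz), h⟩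
  obtain ⟨y, hy⟩ := Set.Nonempty.intrinsicInterior convex_conv ⟨z, hz⟩
  obtain ⟨x, hx⟩ : (openSegment ℝ z y).Nonempty := ⟨_, midpoint_mem_openSegment z y⟩
  refine ⟨x, mem_intrinsicInterior_of_mem_openSegment convex_conv hz hy hx, ?_⟩
  exact convex_conv.openSegment_interior_self_subset_interior hzint
    (conv_mono (subset_univ F) (intrinsicInterior_subset hy)) hx

theorem IsFace.exists_dual (h : IsFace a G B) (hx : x ∈ conv a G) :
    ∃ l : Module.Dual ℝ (EuclideanSpace ℝ (Fin d)), vectorSpan ℝ (a '' G) ≤ LinearMap.ker l ∧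
      ∀ y ∈ dirCone (conv a B) x, 0 ≤ l y → y ∈ vectorSpan ℝ (a '' G) := by
  obtain ⟨f, hf, rfl⟩ := isFace_iff.1 h
  have hconv := conv_sep_eq_zero hf
  refine ⟨f.linear, ?_, fun y hy hly => ?_⟩
  · rw [vectorSpan_def, Submodule.span_le]
    rintro _ ⟨_, ⟨i, hi, rfl⟩, _, ⟨j, hj, rfl⟩, rfl⟩
    exact (f.linearMap_vsub _ _).trans (by simp [hi.2, hj.2])
  · obtain ⟨ε, hε, hmem⟩ := (mem_dirCone convex_conv).1 hy
    have hfε : f (x + ε • y) = ε * f.linear y := by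
      have hfx : f x = 0 := (hconv.subset hx).2
      simpa [hfx, add_comm] using f.map_vadd x (ε • y)
    have hzero : f (x + ε • y) = 0 :=
      (nonpos_of_mem_conv hf hmem).antisymm (hfε ▸ mul_nonneg hε.le hly)
    have hdir := vsub_mem_vectorSpan ℝ (hconv.symm.subset ⟨hmem, hzero⟩) hx
    rw [vectorSpan_conv, vsub_eq_sub, add_sub_cancel_left] at hdir
    exact ((vectorSpan ℝ _).smul_mem_iff hε.ne').1 hdir

namespace IsSubdivision

theorem eq_of_mem_intrinsicInterior (hS : IsSubdivision a S) (hF : F ∈ S) (hG : G ∈ S)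
    (hzF : z ∈ intrinsicInterior ℝ (conv a F)) (hzG : z ∈ intrinsicInterior ℝ (conv a G)) :
    F = G := by
  by_contra hne
  exact disjoint_left.1 (hS.disjoint_relint F hF G hG hne) hzF hzG

variable [Finite ι]

theorem isFace_of_mem_intrinsicInterior (hS : IsSubdivision a S) (hF : F ∈ S) (hB : B ∈ S)
    (hz : z ∈ intrinsicInterior ℝ (conv a F)) (hzB : z ∈ conv a B) : IsFace a F B := by
  obtain ⟨G, hGB, hzG⟩ := exists_isFace_mem_intrinsicInterior hzB
  rwa [hS.eq_of_mem_intrinsicInterior hF (hS.face_mem B hB G hGB) hz hzG]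

theorem isFace_of_subset (hS : IsSubdivision a S) (hF : F ∈ S) (hB : B ∈ S) (h : F ⊆ B) :
    IsFace a F B := by
  rcases F.eq_empty_or_nonempty with rfl | hne
  · exact isFace_empty
  · obtain ⟨z, hz⟩ := Set.Nonempty.intrinsicInterior convex_conv (conv_nonempty (a := a).2 hne)
    exact hS.isFace_of_mem_intrinsicInterior hF hB hz (conv_mono h (intrinsicInterior_subset hz))

theorem exists_common_face (hS : IsSubdivision a S) (hB : B ∈ S) (hC : C ∈ S) (hzB : z ∈ conv a B)
    (hzC : z ∈ conv a C) : ∃ G, IsFace a G B ∧ IsFace a G C ∧ z ∈ conv a G := by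
  obtain ⟨G, hGB, hz⟩ := exists_isFace_mem_intrinsicInterior hzB
  exact ⟨G, hGB, hS.isFace_of_mem_intrinsicInterior (hS.face_mem B hB G hGB) hC hz hzC,
    intrinsicInterior_subset hz⟩

theorem isFace_inter (hS : IsSubdivision a S) (hB : B ∈ S) (hC : C ∈ S) :
    IsFace a (B ∩ C) B := by
  rcases (B ∩ C).eq_empty_or_nonempty with h | hne
  · exact h ▸ isFace_empty
  · obtain ⟨z, hz⟩ := Set.Nonempty.intrinsicInterior convex_conv (conv_nonempty (a := a).2 hne)
    have hzBC := intrinsicInterior_subset hz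
    obtain ⟨G, hGB, hGC, hzG⟩ := hS.exists_common_face hB hC (conv_mono inter_subset_left hzBC)
      (conv_mono inter_subset_right hzBC)
    have heq : B ∩ C = G := (hGB.subset_of_mem_intrinsicInterior inter_subset_left hz hzG).antisymm
      (subset_inter hGB.subset hGC.subset)
    rwa [heq]

theorem mem_dirCone_of_add_mem (hS : IsSubdivision a S) (hB : B ∈ S) (hC : C ∈ S)
    (hxB : x ∈ conv a B) (hxC : x ∈ conv a C) (hy : y ∈ dirCone (conv a B) x)
    (hz : z ∈ dirCone (conv a B) x) (hyz : y + z ∈ dirCone (conv a C) x) :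
    y ∈ dirCone (conv a C) x := by
  have hyz' : (1 / 2 : ℝ) • (y + z) ∈ dirCone (conv a C) x := ConvexCone.smul_mem _ (by simp) hyz
  obtain ⟨ε, ⟨hεy, hεz⟩, hεC, hε⟩ :=
    (((eventually_add_smul_mem_of_mem_dirCone convex_conv hxB hy).and
      (eventually_add_smul_mem_of_mem_dirCone convex_conv hxB hz)).and
      ((eventually_add_smul_mem_of_mem_dirCone convex_conv hxC hyz').and
        (eventually_mem_nhdsWithin (s := Ioi 0)))).exists
  have hmid : x + ε • (1 / 2 : ℝ) • (y + z) ∈ openSegment ℝ (x + ε • y) (x + ε • z) :=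
    ⟨1 / 2, 1 / 2, by simp, by simp, by norm_num, by module⟩
  obtain ⟨G, hGB, hGC, hG⟩ := hS.exists_common_face hB hC
    (convex_conv.openSegment_subset hεy hεz hmid) hεC
  exact (mem_dirCone convex_conv).2 ⟨ε, hε,
    conv_mono hGC.subset (hGB.isExtreme.left_mem_of_mem_openSegment hεy hεz hG hmid)⟩

theorem sub_mem_dirCone_iff (hS : IsSubdivision a S) (hB : B ∈ S) (hC : C ∈ S)
    (hxB : x ∈ conv a B) (hxC : x ∈ conv a C) (hi : i ∈ B) :
    a i - x ∈ dirCone (conv a C) x ↔ i ∈ C := by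
  refine ⟨fun h => ?_, fun h => sub_mem_dirCone (mem_conv_of_mem h)⟩
  obtain ⟨ε, hεC, hε⟩ := ((eventually_add_smul_mem_of_mem_dirCone convex_conv hxC h).and
    (Ioo_mem_nhdsGT one_pos)).exists
  have hseg : x + ε • (a i - x) ∈ openSegment ℝ (a i) x :=
    ⟨ε, 1 - ε, hε.1, by simpa using hε.2, by ring, by module⟩
  have hiB : a i ∈ conv a B := mem_conv_of_mem hi
  obtain ⟨G, hGB, hGC, hG⟩ := hS.exists_common_face hB hC
    (convex_conv.openSegment_subset hiB hxB hseg) hεC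
  exact hGC.subset (hGB.mem_of_mem_conv hi
    (hGB.isExtreme.left_mem_of_mem_openSegment hiB hxB hG hseg))

end IsSubdivision

/-- The inclusion-maximal faces of a subdivision. -/
def cells (S : Set (Set ι)) : Set (Set ι) :=
  {C | Maximal (· ∈ S) C}

variable [Finite ι]

theorem exists_mem_cells_superset (hF : F ∈ S) : ∃ C ∈ cells S, F ⊆ C := by
  obtain ⟨C, hFC, hC⟩ := (toFinite S).exists_le_maximal hF
  exact ⟨C, hC, hFC⟩

namespace IsSubdivision

theorem exists_mem_cells (hS : IsSubdivision a S) (hz : z ∈ conv a univ) :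
    ∃ C ∈ cells S, z ∈ conv a C := by
  obtain ⟨F, hF, hzF⟩ := mem_iUnion₂.1 (hS.iUnion_conv ▸ hz)
  obtain ⟨C, hC, hFC⟩ := exists_mem_cells_superset hF
  exact ⟨C, hC, conv_mono hFC hzF⟩

theorem exists_mem_dirCone (hS : IsSubdivision a S) (hx : x ∈ interior (conv a univ))
    (y : EuclideanSpace ℝ (Fin d)) :
    ∃ C ∈ cells S, x ∈ conv a C ∧ y ∈ dirCone (conv a C) x := by
  have hlim : Tendsto (fun ε : ℝ => x + ε • y) (𝓝[>] 0) (𝓝 x) := by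
    have hcont : Continuous fun ε : ℝ => x + ε • y := by fun_prop
    simpa using (hcont.tendsto 0).mono_left nhdsWithin_le_nhds
  have hcover : ∀ᶠ ε in 𝓝[>] (0 : ℝ), ∃ C : cells S, x + ε • y ∈ conv a C := by
    filter_upwards [hlim (mem_interior_iff_mem_nhds.1 hx)] with ε hε
    obtain ⟨C, hC, hmem⟩ := hS.exists_mem_cells hε
    exact ⟨⟨C, hC⟩, hmem⟩
  obtain ⟨C, hC⟩ := frequently_exists.1 hcover.frequently
  obtain ⟨ε, hmem, hε⟩ := (hC.and_eventually self_mem_nhdsWithin).exists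
  exact ⟨C, C.2, isClosed_conv.mem_of_frequently_of_tendsto hC hlim,
    (mem_dirCone convex_conv).2 ⟨ε, hε, hmem⟩⟩

theorem le_dim_add_ncard (hS : IsSubdivision a S) (hG : G ∈ S) (hint : IsInterior a G) :
    d + 1 ≤ dim a G + {C | C ∈ cells S ∧ G ⊆ C}.ncard := by
  obtain ⟨x, hxG, hx⟩ := hint.exists_mem_intrinsicInterior
  let J := {C | C ∈ cells S ∧ G ⊆ C}
  have hface : ∀ C : J, IsFace a G C := fun C => hS.isFace_of_subset hG C.2.1.prop C.2.2
  choose l hlG hl using fun C => (hface C).exists_dual (intrinsicInterior_subset hxG)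
  by_contra! hlt
  have := Fintype.ofFinite J
  obtain ⟨C₀, hC₀⟩ := exists_mem_cells_superset hG
  have : Nonempty J := ⟨C₀, hC₀⟩
  obtain ⟨y, hyG, hy⟩ := exists_notMem_forall_nonneg hlG (by
    rw [finrank_euclideanSpace_fin, ← Nat.card_eq_fintype_card, Nat.card_coe_set_eq]
    exact Nat.le_of_lt_succ hlt)
  obtain ⟨C, hC, hxC, hyC⟩ := hS.exists_mem_dirCone hx y
  have hGC := (hS.isFace_of_mem_intrinsicInterior hG hC.prop hxG hxC).subset
  exact hyG (hl ⟨C, hC, hGC⟩ y hyC (hy _))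

theorem subset_of_mem_cells (hS : IsSubdivision a S) (hF : F ∈ S) (hint : IsInterior a F)
    (hcard : dim a F + (cells S).ncard ≤ d + 1) (hC : C ∈ cells S) : F ⊆ C := by
  have heq : {C | C ∈ cells S ∧ F ⊆ C} = cells S := by
    refine eq_of_subset_of_ncard_le (fun C hC => hC.1) ?_
    have hle := hS.le_dim_add_ncard hF hint
    lia
  exact (heq.symm.subset hC).2

theorem exists_mem_iff_ne (hS : IsSubdivision a S) (hF : F ∈ S) (hint : IsInterior a F)
    (hcard : dim a F + (cells S).ncard ≤ d + 1) (hC : C ∈ cells S) (hD : D ∈ cells S)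
    (hDC : D ≠ C) : ∃ p, ∀ B ∈ cells S, p ∈ B ↔ C ≠ B := by
  have hFD := hS.subset_of_mem_cells hF hint hcard hD
  have hFC := hS.subset_of_mem_cells hF hint hcard hC
  obtain ⟨H, hHD, hFH, hHC⟩ := (hS.isFace_of_subset hF hD.prop hFD).exists_ssuperset_inter_eq
    (hS.isFace_inter hD.prop hC.prop) (subset_inter hFD hFC)
    fun h => hDC (hD.eq_of_subset hC.prop (inter_eq_left.1 h))
  obtain ⟨G, hGH, hG⟩ := (toFinite {G | IsFace a G D ∧ F ⊂ G}).exists_le_minimal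
    (a := H) ⟨hHD, hFH⟩
  obtain ⟨hGD, hFG⟩ := hG.prop
  have hGS : G ∈ S := hS.face_mem D hD.prop G hGD
  have hdimG : dim a G ≤ dim a F + 1 :=
    (hS.isFace_of_subset hF hGS hFG.subset).dim_le_add_one_of_covBy hint.nonempty hFG
      fun B hB hFB => hG.eq_of_subset ⟨hB.trans hGD, hFB⟩ hB.subset
  obtain ⟨p, hpG, hpF⟩ := exists_of_ssubset hFG
  have hpC : p ∉ C := fun h => hpF (hHC.subset ⟨hGH hpG, hGD.subset hpG, h⟩)
  have hcells : {B | B ∈ cells S ∧ G ⊆ B} = cells S \ {C} := by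
    refine eq_of_subset_of_ncard_le (fun B hB => ⟨hB.1, fun h => hpC (h ▸ hB.2 hpG)⟩) ?_
    have hle := hS.le_dim_add_ncard hGS (hint.mono hFG.subset)
    have hdiff := ncard_sdiff_singleton_add_one hC
    lia
  exact ⟨p, fun B hB => ⟨fun hpB h => hpC (h ▸ hpB),
    fun h => (hcells.symm.subset ⟨hB, h.symm⟩).2 hpG⟩⟩

theorem isSimplexFan (hS : IsSubdivision a S) (hFC : ∀ C ∈ cells S, F ⊆ C)
    (hx : x ∈ intrinsicInterior ℝ (conv a F)) [Nontrivial (cells S)] {p : cells S → ι}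
    (hp : ∀ C B : cells S, p C ∈ (B : Set ι) ↔ C ≠ B) :
    IsSimplexFan (vectorSpan ℝ (a '' F)) (fun C : cells S => dirCone (conv a C) x)
      fun C => a (p C) - x where
  submodule_subset C := by
    rw [← vectorSpan_conv]
    exact (vectorSpan_subset_dirCone convex_conv hx).trans (dirCone_mono (conv_mono (hFC C C.2)))
  mem_of_add_mem {B C _ _} := hS.mem_dirCone_of_add_mem B.2.prop C.2.prop
    (conv_mono (hFC B B.2) (intrinsicInterior_subset hx))
    (conv_mono (hFC C C.2) (intrinsicInterior_subset hx))
  ray_mem_iff {C B} := by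
    obtain ⟨D, hDC⟩ := exists_ne C
    rw [hS.sub_mem_dirCone_iff D.2.prop B.2.prop
      (conv_mono (hFC D D.2) (intrinsicInterior_subset hx))
      (conv_mono (hFC B B.2) (intrinsicInterior_subset hx)) ((hp C D).2 hDC.symm), hp]

theorem exists_affineMap (hS : IsSubdivision a S) (hF : F ∈ S) (hint : IsInterior a F)
    (hcard : dim a F + (cells S).ncard ≤ d + 1) :
    ∃ g : cells S → EuclideanSpace ℝ (Fin d) →ᵃ[ℝ] ℝ, ∀ B : cells S, ∀ i ∈ (B : Set ι),
      ∀ C : cells S, i ∈ (C : Set ι) ↔ ∀ D, g D (a i) ≤ g C (a i) := by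
  rcases subsingleton_or_nontrivial (cells S) with hsub | hnontriv
  · exact ⟨0, fun B i hi C => by simpa [Subsingleton.elim C B] using hi⟩
  have := Fintype.ofFinite (cells S)
  obtain ⟨x, hx, -⟩ := hint.exists_mem_intrinsicInterior
  have hFC : ∀ C ∈ cells S, F ⊆ C := fun C => hS.subset_of_mem_cells hF hint hcard
  have hray : ∀ C : cells S, ∃ p, ∀ B : cells S, p ∈ (B : Set ι) ↔ C ≠ B := fun C => by
    obtain ⟨D, hDC⟩ := exists_ne C
    obtain ⟨p, hp⟩ := hS.exists_mem_iff_ne hF hint hcard C.2 D.2 (Subtype.coe_ne_coe.2 hDC)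
    exact ⟨p, fun B => (hp B B.2).trans Subtype.coe_ne_coe⟩
  choose p hp using hray
  have hrank : Module.finrank ℝ (EuclideanSpace ℝ (Fin d)) <
      Module.finrank ℝ (vectorSpan ℝ (a '' F)) + Fintype.card (cells S) := by
    have hle := hS.le_dim_add_ncard hF hint
    have hmono : {C | C ∈ cells S ∧ F ⊆ C}.ncard ≤ (cells S).ncard :=
      ncard_le_ncard (sep_subset _ _)
    rw [finrank_euclideanSpace_fin, ← Nat.card_eq_fintype_card, Nat.card_coe_set_eq]
    change d < dim a F + (cells S).ncard
    lia
  obtain ⟨l, hl⟩ := (hS.isSimplexFan hFC hx hp).exists_dual hrank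
  refine ⟨fun C => (l C).toAffineMap - AffineMap.const ℝ _ (l C x), fun B i hi C => ?_⟩
  rw [← hS.sub_mem_dirCone_iff B.2.prop C.2.prop
    (conv_mono (hFC B B.2) (intrinsicInterior_subset hx))
    (conv_mono (hFC C C.2) (intrinsicInterior_subset hx)) hi, hl]
  simp

end IsSubdivision

end Subdivisions

section Regularity

open Set Filter Topology

variable {d : ℕ} {ι : Type*} {a : ι → EuclideanSpace ℝ (Fin d)} {S : Set (Set ι)} {C F G : Set ι}
  {w : ι → ℝ} {z : EuclideanSpace ℝ (Fin d)}

theorem lifted_mem_lift (i : ι) : (w i, a i) ∈ lift a w :=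
  ⟨_, subset_convexHull ℝ _ (mem_range_self i), 0, le_rfl, by simp⟩

theorem add_mem_lift {x : ℝ × EuclideanSpace ℝ (Fin d)} (hx : x ∈ lift a w) {t : ℝ} (ht : 0 ≤ t) :
    x + (t, 0) ∈ lift a w := by
  obtain ⟨y, hy, s, hs, rfl⟩ := hx
  exact ⟨y, hy, s + t, add_nonneg hs ht, by rw [add_assoc]; simp⟩

theorem neg_of_isBounded_sep_eq_zero {f : ℝ × EuclideanSpace ℝ (Fin d) →ᵃ[ℝ] ℝ}
    (hf : ∀ y ∈ lift a w, f y ≤ 0) (hb : Bornology.IsBounded {y | y ∈ lift a w ∧ f y = 0})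
    (hne : {y | y ∈ lift a w ∧ f y = 0}.Nonempty) : f.linear (1, 0) < 0 := by
  obtain ⟨x, hx, hfx⟩ := hne
  have hray : ∀ t : ℝ, f (x + (t, 0)) = t * f.linear (1, 0) := fun t => by
    have hmap := f.map_vadd x (t • (1, 0))
    rw [map_smul, hfx] at hmap
    simpa [add_comm] using hmap
  have hle : f.linear (1, 0) ≤ 0 := by
    simpa [hray] using hf _ (add_mem_lift hx zero_le_one)
  refine hle.lt_of_ne fun hzero => ?_
  obtain ⟨R, hR⟩ := hb.image_fst.bddAbove
  have hRx : x.1 + (|R - x.1| + 1) ≤ R :=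
    hR ⟨x + (|R - x.1| + 1, 0), ⟨add_mem_lift hx (by positivity), by simp [hray, hzero]⟩, rfl⟩
  linarith [le_abs_self (R - x.1)]

theorem exists_affineMap_of_mem_regularSubdivision (hF : F ∈ regularSubdivision a w)
    (hne : F.Nonempty) :
    ∃ u : EuclideanSpace ℝ (Fin d) →ᵃ[ℝ] ℝ, (∀ i, u (a i) ≤ w i) ∧ F = {i | u (a i) = w i} := by
  obtain ⟨G, hG, hb, rfl⟩ := hF
  obtain ⟨f, hf, rfl⟩ := isExposed_iff_exists_affineMap.1 hG
  obtain ⟨j, hj⟩ := hne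
  have hneg := neg_of_isBounded_sep_eq_zero hf hb ⟨_, hj⟩
  have hdecomp : ∀ i, f (w i, a i) = w i * f.linear (1, 0) + f (0, a i) := fun i => by
    have hmap := f.map_vadd (0, a i) (w i • (1, 0))
    rw [map_smul] at hmap
    simpa using hmap
  refine ⟨-(f.linear (1, 0))⁻¹ • f.comp (LinearMap.inr ℝ ℝ _).toAffineMap, fun i => ?_,
    ext fun i => (and_iff_right (lifted_mem_lift i)).trans ?_⟩
  all_goals
    have hval : (-(f.linear (1, 0))⁻¹ • f.comp (LinearMap.inr ℝ ℝ _).toAffineMap) (a i) =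
        -f (0, a i) / f.linear (1, 0) := by
      simp [div_eq_inv_mul]
  · rw [hval, div_le_iff_of_neg hneg]
    linarith [hf _ (lifted_mem_lift i), hdecomp i]
  · rw [mem_ofPred_eq, hval, div_eq_iff hneg.ne, hdecomp, neg_eq_iff_add_eq_zero, add_comm]

theorem mem_regularSubdivision_of_affineMap [Finite ι] {u : EuclideanSpace ℝ (Fin d) →ᵃ[ℝ] ℝ}
    (hu : ∀ i, u (a i) ≤ w i) : {i | u (a i) = w i} ∈ regularSubdivision a w := by
  let f : ℝ × EuclideanSpace ℝ (Fin d) →ᵃ[ℝ] ℝ :=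
    u.comp (LinearMap.snd ℝ ℝ _).toAffineMap - (LinearMap.fst ℝ ℝ _).toAffineMap
  have hhull : ∀ y ∈ convexHull ℝ (range fun i => (w i, a i)), f y ≤ 0 :=
    convexHull_min (t := f ⁻¹' Iic 0) (forall_mem_range.2 fun i => sub_nonpos.2 (hu i))
      ((convex_Iic 0).affine_preimage f)
  have hray : ∀ y t, f (y + (t, 0)) = f y - t := fun y t => by simp [f, sub_sub]
  have hlift : ∀ y ∈ lift a w, f y ≤ 0 := by
    rintro _ ⟨y, hy, t, ht, rfl⟩
    linarith [hray y t, hhull y hy]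
  refine ⟨_, isExposed_iff_exists_affineMap.2 ⟨f, hlift, rfl⟩, ?_, ext fun i => ?_⟩
  · refine ((finite_range fun i => (w i, a i)).isCompact_convexHull (𝕜 := ℝ)).isBounded.subset ?_
    rintro _ ⟨⟨y, hy, t, ht, rfl⟩, hzero⟩
    obtain rfl : t = 0 := by linarith [hray y t, hhull y hy]
    rwa [Prod.mk_zero_zero, add_zero]
  · exact (sub_eq_zero (a := u (a i))).symm.trans (and_iff_right (lifted_mem_lift i)).symm

theorem mem_regularSubdivision_iff [Finite ι] : F ∈ regularSubdivision a w ↔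
    ∃ u : EuclideanSpace ℝ (Fin d) →ᵃ[ℝ] ℝ, (∀ i, u (a i) ≤ w i) ∧ F = {i | u (a i) = w i} := by
  refine ⟨fun hF => ?_, fun ⟨u, hu, h⟩ => h ▸ mem_regularSubdivision_of_affineMap hu⟩
  rcases F.eq_empty_or_nonempty with rfl | hne
  · obtain ⟨m, hm⟩ := (finite_range w).bddBelow
    have hlt : ∀ i, m - 1 < w i := fun i => (sub_one_lt m).trans_le (hm (mem_range_self i))
    exact ⟨AffineMap.const ℝ _ (m - 1), fun i => (hlt i).le,
      (eq_empty_of_forall_notMem fun i hi => (hlt i).ne hi).symm⟩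
  · exact exists_affineMap_of_mem_regularSubdivision hF hne

theorem mem_regularSubdivision_of_isFace [Finite ι] (hF : F ∈ regularSubdivision a w)
    (hGF : IsFace a G F) : G ∈ regularSubdivision a w := by
  obtain ⟨u, hu, rfl⟩ := mem_regularSubdivision_iff.1 hF
  obtain ⟨f, hf, rfl⟩ := isFace_iff.1 hGF
  have hsmall : ∀ᶠ t in 𝓝[>] (0 : ℝ), ∀ i ∈ {i | u (a i) < w i}, u (a i) + t * f (a i) < w i := by
    refine nhdsWithin_le_nhds ((toFinite _).eventually_all.2 fun i hi => ?_)
    have hcont : Continuous fun t : ℝ => u (a i) + t * f (a i) := by fun_prop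
    exact hcont.continuousAt.eventually_lt_const (by simpa using hi)
  obtain ⟨t, ht, ht0 : 0 < t⟩ := (hsmall.and self_mem_nhdsWithin).exists
  refine mem_regularSubdivision_iff.2 ⟨u + t • f, fun i => ?_, ext fun i => ?_⟩
  all_goals
    simp only [AffineMap.coe_add, AffineMap.coe_smul, Pi.add_apply, Pi.smul_apply, smul_eq_mul,
      mem_ofPred_eq]
    rcases (hu i).lt_or_eq with hi | hi
  · exact (ht i hi).le
  · simpa [hi] using mul_nonpos_of_nonneg_of_nonpos ht0.le (hf i hi)
  · exact iff_of_false (fun h => hi.ne h.1) (ht i hi).ne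
  · simp [hi, ht0.ne']

theorem isFace_of_mem_regularSubdivision [Finite ι] (hF : F ∈ regularSubdivision a w)
    (hC : C ∈ regularSubdivision a w) (hz : z ∈ intrinsicInterior ℝ (conv a F))
    (hzC : z ∈ conv a C) : IsFace a F C := by
  obtain ⟨u, hu, rfl⟩ := mem_regularSubdivision_iff.1 hF
  obtain ⟨v, hv, rfl⟩ := mem_regularSubdivision_iff.1 hC
  have hzF := intrinsicInterior_subset hz
  have hC_nonpos : ∀ i ∈ {i | v (a i) = w i}, (u - v) (a i) ≤ 0 := fun i hi => by
    simpa [hi.symm] using (hu i).trans_eq hi.symm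
  have hF_nonpos : ∀ i ∈ {i | u (a i) = w i}, (v - u) (a i) ≤ 0 := fun i hi => by
    simpa [hi.symm] using (hv i).trans_eq hi.symm
  have hzero : (v - u) z = 0 := by
    have hle := nonpos_of_mem_conv hC_nonpos hzC
    have hge := nonpos_of_mem_conv hF_nonpos hzF
    simp only [AffineMap.coe_sub, Pi.sub_apply] at hle hge ⊢
    linarith
  have hmem := (conv_sep_eq_zero hF_nonpos).symm.subset ⟨hzF, hzero⟩
  have hsub := (isFace_iff.2 ⟨v - u, hF_nonpos, rfl⟩).subset_of_mem_intrinsicInterior subset_rfl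
    hz hmem
  refine isFace_iff.2 ⟨u - v, hC_nonpos, ext fun i => ⟨fun hi => ?_, fun ⟨hi, huv⟩ => ?_⟩⟩
  · have hvu : v (a i) = u (a i) := sub_eq_zero.1 (hsub hi).2
    exact ⟨hvu.trans hi, sub_eq_zero.2 hvu.symm⟩
  · exact (sub_eq_zero.1 huv).trans hi

namespace IsSubdivision

variable [Finite ι]

theorem eq_regularSubdivision (hS : IsSubdivision a S) (hne : S.Nonempty)
    (hcells : cells S ⊆ regularSubdivision a w) : S = regularSubdivision a w := by
  refine Subset.antisymm (fun F hF => ?_) fun F hF => ?_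
  · obtain ⟨C, hC, hFC⟩ := exists_mem_cells_superset hF
    exact mem_regularSubdivision_of_isFace (hcells hC) (hS.isFace_of_subset hF hC.prop hFC)
  · rcases F.eq_empty_or_nonempty with rfl | hFne
    · obtain ⟨B, hB⟩ := hne
      exact hS.face_mem B hB ∅ isFace_empty
    · obtain ⟨z, hz⟩ :=
        Set.Nonempty.intrinsicInterior convex_conv (conv_nonempty (a := a).2 hFne)
      obtain ⟨C, hC, hzC⟩ :=
        hS.exists_mem_cells (conv_mono (subset_univ F) (intrinsicInterior_subset hz))
      exact hS.face_mem C hC.prop F (isFace_of_mem_regularSubdivision hF (hcells hC) hz hzC)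

theorem isRegular_of_affineMap (hS : IsSubdivision a S) (hne : S.Nonempty)
    (g : cells S → EuclideanSpace ℝ (Fin d) →ᵃ[ℝ] ℝ)
    (hg : ∀ B : cells S, ∀ i ∈ (B : Set ι), ∀ C : cells S,
      i ∈ (C : Set ι) ↔ ∀ D, g D (a i) ≤ g C (a i)) : IsRegular a S := by
  classical
  have hle : ∀ i C, g C (a i) ≤ ⨆ D, g D (a i) := fun i => le_ciSup (finite_range _).bddAbove
  let w : ι → ℝ := fun i => (⨆ D, g D (a i)) + if ∃ C ∈ cells S, i ∈ C then 0 else 1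
  have hle_w : ∀ i C, g C (a i) ≤ w i := fun i C =>
    (hle i C).trans (le_add_of_nonneg_right (by split_ifs <;> norm_num))
  refine ⟨w, hS.eq_regularSubdivision hne fun C hC => mem_regularSubdivision_iff.2
    ⟨g ⟨C, hC⟩, fun i => hle_w i _, ext fun i => ?_⟩⟩
  have : Nonempty (cells S) := ⟨⟨C, hC⟩⟩
  by_cases hi : ∃ B ∈ cells S, i ∈ B
  · obtain ⟨B, hB, hiB⟩ := hi
    have hw : w i = ⨆ D, g D (a i) :=
      (congrArg _ (if_pos ⟨B, hB, hiB⟩)).trans (add_zero _)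
    rw [hg ⟨B, hB⟩ i hiB ⟨C, hC⟩, mem_ofPred_eq, hw]
    exact ⟨fun h => (hle i _).antisymm (ciSup_le h), fun h D => h ▸ hle i D⟩
  · have hw : w i = (⨆ D, g D (a i)) + 1 := congrArg _ (if_neg hi)
    exact iff_of_false (fun h => hi ⟨C, hC, h⟩)
      ((hle i _).trans_lt ((lt_add_one _).trans_eq hw.symm)).ne

end IsSubdivision

end Regularity

end PointConfig

theorem mainTheorem1_general {d : ℕ} {ι : Type*} [Finite ι] (a : ι → EuclideanSpace ℝ (Fin d))
    (S : Set (Set ι)) (hS : PointConfig.IsSubdivision a S) (F : Set ι) (hF : F ∈ S)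
    (hint : PointConfig.IsInterior a F)
    (hcard : PointConfig.dim a F + (PointConfig.cells S).ncard ≤ d + 1) :
    PointConfig.IsRegular a S := by
  obtain ⟨g, hg⟩ := hS.exists_affineMap hF hint hcard
  exact hS.isRegular_of_affineMap ⟨F, hF⟩ g hg

theorem mainTheorem1 {d : ℕ} {ι : Type*} [Finite ι] (a : ι → EuclideanSpace ℝ (Fin d))
    (hdim : affineSpan ℝ (Set.range a) = ⊤) (k : ℕ) (S : Set (Set ι))
    (hS : PointConfig.IsKSplit a k S) :
    PointConfig.IsRegular a S := by
  obtain ⟨F, hF, hint, hk⟩ := hS.exists_interior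
  exact mainTheorem1_general a S hS.isCoarsest.isSubdivision F hF hint
    (hS.ncard_maximal.symm ▸ hk).le
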